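/- Let $A$ be a complex unital Banach algebra that is primitive, i.e. $\{0\}$ is the annihilator of a simple left $A$-module $A/L$ for some maximal left ideal $L$. Let $p\in A$ be a minimal idempotent, i.e. $p\neq 0$, $p^2=p$ and $pAp=\mathbb{C}p$, and let $\operatorname{soc}(A)$ be the socle of $A$, the sum of its minimal left ideals (a two-sided ideal). For $a\in A$ let $\widehat a$ be the bounded operator $y\mapsto ay$ on the Banach space $Ap$, let $L(Ap)$ be the algebra of all bounded operators on $Ap$, let $F_0(Ap)$ be its ideal of finite rank operators, and let $\mathfrak L_r:A\to L(Ap)$, $\mathfrak L_r(a)=\widehat a$, be the left regular representation. Assume that $$\mathfrak L_r(\operatorname{soc}(A))=F_0(Ap).$$ An element $x$ of a unital ring $R$ is called Drazin invertible in $R$ if there are $b\in R$ and $k\in\mathbb N$ with $bxb=b$, $xb=bx$ and $x^kbx=x^k$. An element $a\in A$ is called a B-Fredholm element of $A$ if its class is Drazin invertible in $A/\operatorname{soc}(A)$. A bounded operator $T$ on a Banach space $X$ is called a B-Fredholm operator if for some integer $n\ge 0$ the range $R(T^n)$ is closed and the operator $R(T^n)\to R(T^n)$ induced by $T$ is a Fredholm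 operator. Then the following two conditions are equivalent: (i) for every $a\in A$, if $\widehat a$ is a B-Fredholm operator on $Ap$, then $a$ is a B-Fredholm element of $A$; (ii) every element of the algebra $\mathfrak L_r(A)/F_0(Ap)$ that is Drazin invertible in $L(Ap)/F_0(Ap)$ is Drazin invertible in $\mathfrak L_r(A)/F_0(Ap)$. -/

import Mathlib

namespace BFred

/-- `a` is Drazin invertible: there are `b` and `k ∈ ℕ` with `bab = b`, `ab = ba`,
`a ^ k b a = a ^ k`. -/
def IsDrazinInvertible {R : Type*} [Ring R] (a : R) : Prop :=
  ∃ (b : R) (k : ℕ), b * a * b = b ∧ a * b = b * a ∧ a ^ k * b * a = a ^ k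

/-- `a` is a B-Fredholm element of `R` modulo the two-sided ideal `J`: its image in `R ⧸ J`
is Drazin invertible. -/
def IsBFredholmElement {R : Type*} [Ring R] (J : Ideal R) [J.IsTwoSided] (a : R) : Prop :=
  IsDrazinInvertible (Ideal.Quotient.mk J a)

/-- The ideal `P` is (left) primitive: the annihilator of the simple left module `R ⧸ L`,
for some maximal left ideal `L`. -/
def IsPrimitiveIdeal {R : Type*} [Ring R] (P : Ideal R) : Prop :=
  ∃ L : Ideal R, L.IsMaximal ∧ P = Module.annihilator R (R ⧸ L)

/-- A ring is primitive if `{0}` is a primitive ideal. -/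
def IsPrimitiveRing (R : Type*) [Ring R] : Prop :=
  IsPrimitiveIdeal (⊥ : Ideal R)

/-- The socle of `R`: the sum of all minimal left ideals (`Ideal R` is the type of left ideals;
the sum is `{0}` if there are no minimal left ideals). -/
def socle (R : Type*) [Ring R] : Ideal R :=
  sSup {I : Ideal R | IsAtom I}

/-- The socle is a two-sided ideal: if `I` is a minimal left ideal, then `I b` is either zero or
again a minimal left ideal. -/
instance socle_isTwoSided (R : Type*) [Ring R] : (socle R).IsTwoSided := by
  refine ⟨fun {a} b ha => ?_⟩
  have key : socle R ≤ Submodule.comap (LinearMap.toSpanSingleton R R b) (socle R) := by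
    refine sSup_le fun I hI => ?_
    have hs : IsSimpleModule R I := isSimpleModule_iff_isAtom.mpr hI
    let f : I →ₗ[R] R := (LinearMap.toSpanSingleton R R b).comp (Submodule.subtype I)
    suffices h : LinearMap.range f ≤ socle R from fun x hx => h ⟨⟨x, hx⟩, rfl⟩
    rcases LinearMap.injective_or_eq_zero f with hinj | hzero
    · refine le_sSup ?_
      have e := LinearEquiv.ofInjective f hinj
      exact isSimpleModule_iff_isAtom.mp (IsSimpleModule.congr e.symm)
    · rw [hzero, LinearMap.range_zero]
      exact bot_le
  have h := key ha
  simpa using h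

section FiniteRank

variable (X : Type*) [NormedAddCommGroup X] [NormedSpace ℂ X]

/-- `F₀(X)`: the ideal of finite rank operators in the algebra `L(X)` of bounded operators. -/
def finiteRank : Ideal (X →L[ℂ] X) where
  carrier := {T | FiniteDimensional ℂ (LinearMap.range (T : X →ₗ[ℂ] X))}
  zero_mem' := by
    change FiniteDimensional ℂ (LinearMap.range (0 : X →ₗ[ℂ] X))
    rw [LinearMap.range_zero]
    infer_instance
  add_mem' := by
    intro S T hS hT
    simp only [Set.mem_ofPred_eq] at hS hT ⊢
    refine Submodule.finiteDimensional_of_le (S₂ := LinearMap.range (S : X →ₗ[ℂ] X) ⊔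
      LinearMap.range (T : X →ₗ[ℂ] X)) ?_
    exact LinearMap.range_add_le _ _
  smul_mem' := by
    intro S T hT
    simp only [Set.mem_ofPred_eq] at hT ⊢
    have h : LinearMap.range ((S • T : X →L[ℂ] X) : X →ₗ[ℂ] X) =
        (LinearMap.range (T : X →ₗ[ℂ] X)).map (S : X →ₗ[ℂ] X) :=
      LinearMap.range_comp _ _
    rw [h]
    infer_instance

instance finiteRank_isTwoSided : (finiteRank X).IsTwoSided := by
  refine ⟨fun {T} S hT => ?_⟩
  have hT' : FiniteDimensional ℂ (LinearMap.range (T : X →ₗ[ℂ] X)) := hT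
  change FiniteDimensional ℂ (LinearMap.range ((T * S : X →L[ℂ] X) : X →ₗ[ℂ] X))
  exact Submodule.finiteDimensional_of_le
    (LinearMap.range_comp_le_range (S : X →ₗ[ℂ] X) (T : X →ₗ[ℂ] X))

variable {X}

theorem mapsTo_range_pow (T : X →L[ℂ] X) (n : ℕ) :
    ∀ x ∈ LinearMap.range ((T ^ n : X →L[ℂ] X) : X →ₗ[ℂ] X),
      T x ∈ LinearMap.range ((T ^ n : X →L[ℂ] X) : X →ₗ[ℂ] X) := by
  rintro _ ⟨y, rfl⟩
  refine ⟨T y, ?_⟩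
  change (T ^ n * T) y = (T * T ^ n) y
  rw [← pow_succ, ← pow_succ']

/-- `T_n`: the operator induced by `T` on the range `R(T ^ n)`. -/
def restrictRangePow (T : X →L[ℂ] X) (n : ℕ) :
    LinearMap.range ((T ^ n : X →L[ℂ] X) : X →ₗ[ℂ] X) →L[ℂ]
      LinearMap.range ((T ^ n : X →L[ℂ] X) : X →ₗ[ℂ] X) :=
  T.restrict (mapsTo_range_pow T n)

/-- `T` is a B-Fredholm operator: for some `n ≥ 0` the range of `T ^ n` is closed and the operator
induced by `T` on this range is a Fredholm operator. -/
def IsBFredholmOperator (T : X →L[ℂ] X) : Prop :=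
  ∃ n : ℕ, IsClosed (LinearMap.range ((T ^ n : X →L[ℂ] X) : X →ₗ[ℂ] X) : Set X) ∧
    (restrictRangePow T n).IsFredholm

end FiniteRank

section Representation

variable {A : Type*} [NormedRing A] [NormedAlgebra ℂ A]

/-- `p` is a minimal idempotent: a nonzero idempotent with `pAp = ℂp`. -/
def IsMinimalIdempotent (p : A) : Prop :=
  p ≠ 0 ∧ p * p = p ∧ Set.range (fun a : A => p * a * p) = Set.range (fun c : ℂ => c • p)

/-- The left ideal `Ap = {ap : a ∈ A}`, as a normed space with the norm of `A`. -/
noncomputable def leftIdeal (p : A) : Submodule ℂ A :=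
  LinearMap.range (LinearMap.mulRight ℂ p)

theorem mul_mem_leftIdeal (p a : A) : ∀ y ∈ leftIdeal p, ContinuousLinearMap.mul ℂ A a y ∈
    leftIdeal p := by
  rintro _ ⟨b, rfl⟩
  exact ⟨a * b, by simp [mul_assoc]⟩

/-- The left regular representation `A → L(Ap)`, which sends `a` to the operator `y ↦ ay`. -/
noncomputable def leftRegular (p : A) : A →ₐ[ℂ] (leftIdeal p →L[ℂ] leftIdeal p) where
  toFun a := (ContinuousLinearMap.mul ℂ A a).restrict (mul_mem_leftIdeal p a)
  map_one' := by ext y; simp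
  map_mul' a b := by ext y; simp [mul_assoc]
  map_zero' := by ext y; simp
  map_add' a b := by ext y; simp
  commutes' c := by ext y; simp [Algebra.algebraMap_eq_smul_one]

theorem leftRegular_apply (p a : A) (y : leftIdeal p) :
    ((leftRegular p a y : leftIdeal p) : A) = a * y := rfl

/-- The algebra of operators `{y ↦ ay : a ∈ A}`, the image of the left regular representation
(as a ring: Drazin invertibility does not involve the scalars). -/
noncomputable def image (p : A) : Subring (leftIdeal p →L[ℂ] leftIdeal p) :=
  (leftRegular p : A →+* (leftIdeal p →L[ℂ] leftIdeal p)).range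

/-- `F₀(Ap)` as an ideal of the image of the left regular representation (its trace on the image,
which is `F₀(Ap)` itself as soon as the image contains all finite rank operators). -/
noncomputable def finiteRankInImage (p : A) : Ideal (image p) :=
  (finiteRank (leftIdeal p)).comap (image p).subtype

instance finiteRankInImage_isTwoSided (p : A) : (finiteRankInImage p).IsTwoSided :=
  inferInstanceAs ((finiteRank (leftIdeal p)).comap (image p).subtype).IsTwoSided

/-- The homomorphism from (image of `A` in `L(Ap)`) `/ F₀(Ap)` to `L(Ap) / F₀(Ap)` induced by the
inclusion. -/
noncomputable def imageQuotientInclusion (p : A) :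
    image p ⧸ finiteRankInImage p →+*
      (leftIdeal p →L[ℂ] leftIdeal p) ⧸ finiteRank (leftIdeal p) :=
  Ideal.quotientMap (finiteRank (leftIdeal p)) (image p).subtype le_rfl

theorem imageQuotientInclusion_injective (p : A) :
    Function.Injective (imageQuotientInclusion p) :=
  Ideal.quotientMap_injective

end Representation

end BFred

/-!
Berkani's theorem says that an operator `T` is B-Fredholm if and only if it is Drazin invertible
modulo finite rank: sandwiching operators on `R(T ^ n)` between `T ^ n : X → R(T ^ n)` and the
inclusion `R(T ^ n) → X` reflects congruence modulo finite rank, which carries inverses of the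
induced operator to Drazin inverses of `T` and back. On the other hand, when the preimage of
`F₀(Ap)` in `A` is the socle, `A / soc(A)` and `𝔏ᵣ(A) / F₀(Ap)` are isomorphic. So both
conditions of the theorem assert, for each `a : A`, the same implication between Drazin
invertibility of the class of `â` in `L(Ap) / F₀(Ap)` and in `𝔏ᵣ(A) / F₀(Ap)`.
-/

namespace BFred

section Drazin

variable {R S : Type*} [Ring R] [Ring S]

theorem IsDrazinInvertible.map (f : R →+* S) {a : R} (h : IsDrazinInvertible a) :
    IsDrazinInvertible (f a) := by
  obtain ⟨b, k, hbab, hab, hk⟩ := h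
  refine ⟨f b, k, ?_, ?_, ?_⟩
  · rw [← map_mul, ← map_mul, hbab]
  · rw [← map_mul, ← map_mul, hab]
  · rw [← map_pow, ← map_mul, ← map_mul, hk]

theorem isDrazinInvertible_map_iff {f : R →+* S} (hf : Function.Bijective f) {a : R} :
    IsDrazinInvertible (f a) ↔ IsDrazinInvertible a := by
  refine ⟨fun h => ?_, .map f⟩
  let e := RingEquiv.ofBijective f hf
  simpa only [RingHom.coe_coe, e.symm_apply_apply] using
    IsDrazinInvertible.map (e.symm : S →+* R) (a := e a) h

theorem isBFredholmElement_comap_iff {f : R →+* S} (hf : Function.Surjective f) {J : Ideal S}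
    [J.IsTwoSided] {a : R} : IsBFredholmElement (J.comap f) a ↔ IsBFredholmElement J (f a) :=
  (isDrazinInvertible_map_iff
    ⟨Ideal.quotientMap_injective, Ideal.quotientMap_surjective (H := le_rfl) hf⟩).symm

theorem pow_mul_pow_mul_pow_eq_of_commute {M : Type*} [Monoid M] {x b : M} {n : ℕ}
    (hc : Commute x b) (h : x ^ n * b * x = x ^ n) (m : ℕ) : x ^ n * b ^ m * x ^ m = x ^ n := by
  have hs : SemiconjBy (x ^ n) (b * x) 1 := by
    rw [SemiconjBy, one_mul, ← mul_assoc, h]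
  rw [mul_assoc, ← hc.symm.mul_pow, (hs.pow_right m).eq, one_pow, one_mul]

end Drazin

section FiniteRank

theorem hasFiniteRange_comp_comp_iff {K V W V' W' : Type*} [Ring K]
    [AddCommGroup V] [Module K V] [AddCommGroup W] [Module K W]
    [AddCommGroup V'] [Module K V'] [AddCommGroup W'] [Module K W']
    {i : W →ₗ[K] W'} (hi : Function.Injective i) {q : V' →ₗ[K] V} (hq : Function.Surjective q)
    {f : V →ₗ[K] W} : (i ∘ₗ f ∘ₗ q).HasFiniteRange ↔ f.HasFiniteRange := by
  rw [LinearMap.HasFiniteRange, LinearMap.HasFiniteRange, LinearMap.range_comp,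
    LinearMap.range_comp_of_range_eq_top _ (LinearMap.range_eq_top.2 hq)]
  exact ⟨Submodule.fg_of_fg_map_injective i hi, fun h => h.map i⟩

/-- The subspace `ker (u ∘ v - 1)` is closed, is contained in the range of `u`, and its preimage
under `u` is `ker (u ∘ v ∘ u - u)`, which has finite codimension. -/
theorem isClosed_range_of_hasFiniteRange_comp_comp_sub {𝕜 E F : Type*}
    [NontriviallyNormedField 𝕜] [CompleteSpace 𝕜] [NormedAddCommGroup E] [NormedSpace 𝕜 E]
    [NormedAddCommGroup F] [NormedSpace 𝕜 F] {u : E →L[𝕜] F} {v : F →L[𝕜] E}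
    (h : (u ∘L v ∘L u - u : E →L[𝕜] F).toLinearMap.HasFiniteRange) :
    IsClosed (u.range : Set F) := by
  let N : Submodule 𝕜 F := (u ∘L v - .id 𝕜 F : F →L[𝕜] F).ker
  have hN : N ≤ u.range := fun y hy => ⟨v y, sub_eq_zero.1 hy⟩
  have hcomap : N.comap u.toLinearMap = (u ∘L v ∘L u - u : E →L[𝕜] F).ker :=
    Submodule.ext fun _ => Iff.rfl
  have : (N.comap u.toLinearMap).CoFG := hcomap ▸ LinearMap.ker_coFG_iff_hasFiniteRange.2 h
  refine LinearMap.isClosed_range_of_isClosed_map_of_finiteDimensional_quotient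
    (s := N.comap u.toLinearMap) ?_
  rw [Submodule.map_comap_eq_of_le hN]
  exact (u ∘L v - .id 𝕜 F).isClosed_ker

variable {X : Type*} [NormedAddCommGroup X] [NormedSpace ℂ X]

theorem mem_finiteRank_iff_hasFiniteRange {T : X →L[ℂ] X} :
    T ∈ finiteRank X ↔ T.toLinearMap.HasFiniteRange :=
  Submodule.fg_iff_finiteDimensional _ |>.symm

theorem mk_finiteRank_eq_mk_iff {S T : X →L[ℂ] X} :
    Ideal.Quotient.mk (finiteRank X) S = Ideal.Quotient.mk (finiteRank X) T ↔
      (S - T).toLinearMap.HasFiniteRange := by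
  rw [Ideal.Quotient.eq, mem_finiteRank_iff_hasFiniteRange]

theorem isClosed_range_of_mk_mul_mk_mul_mk {W V : X →L[ℂ] X}
    (h : Ideal.Quotient.mk (finiteRank X) W * Ideal.Quotient.mk (finiteRank X) V *
      Ideal.Quotient.mk (finiteRank X) W = Ideal.Quotient.mk (finiteRank X) W) :
    IsClosed (W.range : Set X) := by
  rw [← map_mul, ← map_mul, mul_assoc, mk_finiteRank_eq_mk_iff] at h
  exact isClosed_range_of_hasFiniteRange_comp_comp_sub h

/-- Atkinson's theorem, with finite rank operators in place of compact ones. -/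
theorem isFredholm_iff_isUnit_mk_finiteRank {T : X →L[ℂ] X} :
    T.IsFredholm ↔ IsUnit (Ideal.Quotient.mk (finiteRank X) T) := by
  have hquasi (S : X →L[ℂ] X) : S.IsQuasiInverse T.toLinearMap ↔
      Ideal.Quotient.mk (finiteRank X) (S * T) = Ideal.Quotient.mk (finiteRank X) 1 ∧
        Ideal.Quotient.mk (finiteRank X) (T * S) = Ideal.Quotient.mk (finiteRank X) 1 := by
    rw [mk_finiteRank_eq_mk_iff, mk_finiteRank_eq_mk_iff]
    exact and_congr LinearMap.FiniteRangeSetoid.equiv_iff_hasFiniteRange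
      LinearMap.FiniteRangeSetoid.equiv_iff_hasFiniteRange
  simp only [ContinuousLinearMap.isFredholm_iff_exists_isQuasiInverse, hquasi, map_mul, map_one,
    isUnit_iff_exists, Ideal.Quotient.mk_surjective.exists, and_comm]

end FiniteRank

section RangePow

variable {X : Type*} [NormedAddCommGroup X] [NormedSpace ℂ X] (T : X →L[ℂ] X) (n : ℕ)

/-- The operator `T ^ n`, regarded as an operator from `X` onto `R(T ^ n)`. -/
def toRangePow : X →L[ℂ] (T ^ n).range :=
  (T ^ n).codRestrict _ fun x => ⟨x, rfl⟩

/-- The operator on `X` that factors through the operator `U` on `R(T ^ n)`: first `T ^ n`, then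
`U`, then the inclusion of `R(T ^ n)`. It transports computations in `L(R(T ^ n))` modulo finite
rank to computations in `L(X)` modulo finite rank. -/
def factorRangePow (U : (T ^ n).range →L[ℂ] (T ^ n).range) : X →L[ℂ] X :=
  (T ^ n).range.subtypeL ∘L U ∘L toRangePow T n

theorem factorRangePow_one : factorRangePow T n 1 = T ^ n := rfl

theorem mul_factorRangePow (U : (T ^ n).range →L[ℂ] (T ^ n).range) :
    T * factorRangePow T n U = factorRangePow T n (restrictRangePow T n * U) := rfl

theorem restrictRangePow_comp_toRangePow :
    restrictRangePow T n ∘L toRangePow T n = toRangePow T n ∘L T := by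
  ext x
  exact congr($((Commute.self_pow T n).eq) x)

theorem factorRangePow_mul (U : (T ^ n).range →L[ℂ] (T ^ n).range) :
    factorRangePow T n U * T = factorRangePow T n (U * restrictRangePow T n) := by
  change (T ^ n).range.subtypeL ∘L U ∘L (toRangePow T n ∘L T) = _
  rw [← restrictRangePow_comp_toRangePow]
  rfl

theorem subtypeL_comp_restrictRangePow_pow (m : ℕ) :
    (T ^ n).range.subtypeL ∘L (restrictRangePow T n ^ m) =
      (T ^ m) ∘L (T ^ n).range.subtypeL := by
  induction m with
  | zero => rfl
  | succ m ih =>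
    calc (T ^ n).range.subtypeL ∘L (restrictRangePow T n ^ (m + 1))
        = ((T ^ n).range.subtypeL ∘L (restrictRangePow T n ^ m)) ∘L restrictRangePow T n := by
          rw [pow_succ]; rfl
      _ = (T ^ (m + 1)) ∘L (T ^ n).range.subtypeL := by
          rw [ih, pow_succ]; rfl

theorem toRangePow_comp_subtypeL :
    toRangePow T n ∘L (T ^ n).range.subtypeL = restrictRangePow T n ^ n := by
  ext x
  exact congr($(subtypeL_comp_restrictRangePow_pow T n n) x).symm

theorem factorRangePow_mul_factorRangePow (U V : (T ^ n).range →L[ℂ] (T ^ n).range) :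
    factorRangePow T n U * factorRangePow T n V =
      factorRangePow T n (U * restrictRangePow T n ^ n * V) := by
  rw [← toRangePow_comp_subtypeL]
  rfl

variable {T n}

theorem mk_factorRangePow_eq_mk_iff {U V : (T ^ n).range →L[ℂ] (T ^ n).range} :
    Ideal.Quotient.mk (finiteRank X) (factorRangePow T n U) =
        Ideal.Quotient.mk (finiteRank X) (factorRangePow T n V) ↔
      Ideal.Quotient.mk (finiteRank _) U = Ideal.Quotient.mk (finiteRank _) V := by
  have hsurj : Function.Surjective (toRangePow T n) := by
    rintro ⟨_, x, rfl⟩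
    exact ⟨x, rfl⟩
  rw [mk_finiteRank_eq_mk_iff, mk_finiteRank_eq_mk_iff,
    ← hasFiniteRange_comp_comp_iff (T ^ n).range.subtype_injective hsurj]
  rfl

/-- If `S` inverts the operator induced on `R(T ^ n)` modulo finite rank, then
`factorRangePow T n (S ^ (n + 1))` is a Drazin inverse of `T` modulo finite rank. -/
theorem isDrazinInvertible_mk_of_isFredholm_restrictRangePow
    (h : (restrictRangePow T n).IsFredholm) :
    IsDrazinInvertible (Ideal.Quotient.mk (finiteRank X) T) := by
  obtain ⟨s, hts, hst⟩ := isUnit_iff_exists.1 (isFredholm_iff_isUnit_mk_finiteRank.1 h)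
  obtain ⟨S, rfl⟩ := Ideal.Quotient.mk_surjective s
  let π := Ideal.Quotient.mk (finiteRank X)
  let B (m : ℕ) : X →L[ℂ] X := factorRangePow T n (S ^ m)
  have hTB : π T * π (B (n + 1)) = π (B n) := by
    rw [← map_mul, mul_factorRangePow, mk_factorRangePow_eq_mk_iff, pow_succ', ← mul_assoc,
      map_mul, map_mul, hts, one_mul]
  have hBT : π (B (n + 1)) * π T = π (B n) := by
    rw [← map_mul, factorRangePow_mul, mk_factorRangePow_eq_mk_iff, pow_succ, mul_assoc,
      map_mul, map_mul, hst, mul_one]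
  refine ⟨π (B (n + 1)), n, ?_, hTB.trans hBT.symm, ?_⟩
  · rw [hBT, ← map_mul, factorRangePow_mul_factorRangePow, mk_factorRangePow_eq_mk_iff, map_mul,
      map_mul, map_pow, map_pow, pow_mul_pow_eq_one n hst, one_mul]
  · rw [mul_assoc, hBT, ← map_pow, ← factorRangePow_one, ← map_mul,
      factorRangePow_mul_factorRangePow, mk_factorRangePow_eq_mk_iff, one_mul, map_mul, map_pow,
      map_pow, map_one, pow_mul_pow_eq_one n hts]

theorem IsBFredholmOperator.of_isDrazinInvertible_mk
    (h : IsDrazinInvertible (Ideal.Quotient.mk (finiteRank X) T)) : IsBFredholmOperator T := by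
  obtain ⟨b, n, -, hc, hn⟩ := h
  obtain ⟨B, rfl⟩ := Ideal.Quotient.mk_surjective b
  let π := Ideal.Quotient.mk (finiteRank X)
  have habsorb := pow_mul_pow_mul_pow_eq_of_commute hc hn
  have hclosed : IsClosed ((T ^ n).range : Set X) :=
    isClosed_range_of_mk_mul_mk_mul_mk (V := B ^ n) (by rw [map_pow, map_pow, habsorb])
  let S : (T ^ n).range →L[ℂ] (T ^ n).range :=
    toRangePow T n ∘L (B ^ (n + 1)) ∘L (T ^ n).range.subtypeL
  have hS : π (factorRangePow T n S) = π T ^ n * π B ^ (n + 1) * π T ^ n := by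
    rw [← map_pow, ← map_pow, ← map_mul, ← map_mul]
    rfl
  have hST : π (factorRangePow T n S) * π T = π T ^ n := by
    rw [hS, mul_assoc, ← pow_succ, habsorb]
  have hcomm : Commute (π T) (π (factorRangePow T n S)) := by
    have hT : Commute (π T) (π T ^ n) := .self_pow _ n
    exact hS ▸ (hT.mul_right (Commute.pow_right hc (n + 1))).mul_right hT
  refine ⟨n, hclosed, isFredholm_iff_isUnit_mk_finiteRank.2 (isUnit_iff_exists.2
    ⟨Ideal.Quotient.mk _ S, ?_, ?_⟩)⟩
  · rw [← map_mul, ← map_one (Ideal.Quotient.mk _), ← mk_factorRangePow_eq_mk_iff,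
      ← mul_factorRangePow, factorRangePow_one, map_mul, map_pow, hcomm.eq, hST]
  · rw [← map_mul, ← map_one (Ideal.Quotient.mk _), ← mk_factorRangePow_eq_mk_iff,
      ← factorRangePow_mul, factorRangePow_one, map_mul, map_pow, hST]

theorem isBFredholmOperator_iff_isBFredholmElement :
    IsBFredholmOperator T ↔ IsBFredholmElement (finiteRank X) T :=
  ⟨fun ⟨_, _, h⟩ => isDrazinInvertible_mk_of_isFredholm_restrictRangePow h,
    .of_isDrazinInvertible_mk⟩

end RangePow

section Representation

variable {A : Type*} [NormedRing A] [NormedAlgebra ℂ A]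

theorem eq_zero_of_mul_mul_eq_zero_of_faithful {R M : Type*} [Ring R] [AddCommGroup M]
    [Module R M] [IsSimpleModule R M] [FaithfulSMul R M] {a p : R} (hp : p ≠ 0)
    (h : ∀ b, a * (b * p) = 0) : a = 0 := by
  obtain ⟨m, hm⟩ : ∃ m : M, p • m ≠ 0 := by
    contrapose! hp
    exact FaithfulSMul.eq_of_smul_eq_smul fun m : M => by rw [hp, zero_smul]
  refine FaithfulSMul.eq_of_smul_eq_smul fun m' : M => ?_
  obtain ⟨b, rfl⟩ := IsSimpleModule.toSpanSingleton_surjective R hm m'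
  rw [LinearMap.toSpanSingleton_apply, smul_smul, smul_smul, mul_assoc, h, zero_smul, zero_smul]

theorem IsPrimitiveRing.eq_zero_of_mul_mul_eq_zero {R : Type*} [Ring R] (hR : IsPrimitiveRing R)
    {a p : R} (hp : p ≠ 0) (h : ∀ b, a * (b * p) = 0) : a = 0 := by
  obtain ⟨L, hL, hann⟩ := hR
  have : IsSimpleModule R (R ⧸ L) := isSimpleModule_iff_isCoatom.2 hL.out
  have : FaithfulSMul R (R ⧸ L) := Module.annihilator_eq_bot.1 hann.symm
  exact eq_zero_of_mul_mul_eq_zero_of_faithful (M := R ⧸ L) hp h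

theorem leftRegular_injective (hA : IsPrimitiveRing A) {p : A} (hp : p ≠ 0) :
    Function.Injective (leftRegular p) := by
  refine (injective_iff_map_eq_zero (leftRegular p)).2 fun a ha => ?_
  refine hA.eq_zero_of_mul_mul_eq_zero hp fun b => ?_
  rw [← leftRegular_apply p a ⟨b * p, b, rfl⟩, ha]
  rfl

/-- The left regular representation, as a homomorphism onto its image. -/
noncomputable def leftRegularToImage (p : A) : A →+* image p :=
  (leftRegular p : A →+* (leftIdeal p →L[ℂ] leftIdeal p)).rangeRestrict

theorem leftRegularToImage_surjective (p : A) : Function.Surjective (leftRegularToImage p) :=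
  RingHom.rangeRestrict_surjective _

theorem comap_leftRegularToImage_finiteRankInImage (p : A) :
    (finiteRankInImage p).comap (leftRegularToImage p) =
      (finiteRank (leftIdeal p)).comap (leftRegular p) :=
  Ideal.ext fun _ => Iff.rfl

theorem imageQuotientInclusion_mk_leftRegularToImage (p a : A) :
    imageQuotientInclusion p (Ideal.Quotient.mk _ (leftRegularToImage p a)) =
      Ideal.Quotient.mk _ (leftRegular p a) :=
  rfl

end Representation

end BFred

theorem theorem3p3_general {A : Type*} [NormedRing A] [NormedAlgebra ℂ A] (p : A) {J : Ideal A}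
    [J.IsTwoSided] (hJ : (BFred.finiteRank (BFred.leftIdeal p)).comap (BFred.leftRegular p) = J) :
    (∀ a : A, BFred.IsBFredholmOperator (BFred.leftRegular p a) →
        BFred.IsBFredholmElement J a) ↔
    (∀ x : BFred.image p ⧸ BFred.finiteRankInImage p,
        BFred.IsDrazinInvertible (BFred.imageQuotientInclusion p x) →
          BFred.IsDrazinInvertible x) := by
  obtain rfl := (BFred.comap_leftRegularToImage_finiteRankInImage p).trans hJ
  have hsurj := BFred.leftRegularToImage_surjective p
  rw [(Ideal.Quotient.mk_surjective.comp hsurj).forall]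
  refine forall_congr' fun a => ?_
  rw [Function.comp_apply, BFred.imageQuotientInclusion_mk_leftRegularToImage]
  exact imp_congr BFred.isBFredholmOperator_iff_isBFredholmElement
    (BFred.isBFredholmElement_comap_iff hsurj)

theorem theorem3p3 {A : Type*} [NormedRing A] [NormedAlgebra ℂ A] [CompleteSpace A]
    (hA : BFred.IsPrimitiveRing A) (p : A) (hp : BFred.IsMinimalIdempotent p)
    (hsoc : BFred.leftRegular p '' (BFred.socle A : Set A) =
      (BFred.finiteRank (BFred.leftIdeal p) : Set (BFred.leftIdeal p →L[ℂ] BFred.leftIdeal p))) :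
    (∀ a : A, BFred.IsBFredholmOperator (BFred.leftRegular p a) →
        BFred.IsBFredholmElement (BFred.socle A) a) ↔
    (∀ x : BFred.image p ⧸ BFred.finiteRankInImage p,
        BFred.IsDrazinInvertible (BFred.imageQuotientInclusion p x) →
          BFred.IsDrazinInvertible x) := by
  refine theorem3p3_general p (SetLike.coe_injective ?_)
  rw [Ideal.coe_comap, ← hsoc, (BFred.leftRegular_injective hA hp.1).preimage_image]
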